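/- Let $F$ be an arbitrary field, let $n \ge 1$ and let $A \in M_n(F)$ be an $n \times n$ matrix over $F$. Then there are nilpotent matrices $N_1, N_2 \in M_n(F)$ with $A = N_1 N_2$ if and only if $A$ is singular and it is not the case that $n = 2$ and $A$ is a nonzero nilpotent matrix. (So for every $A$ other than a nonzero nilpotent $2 \times 2$ matrix, $A$ is a product of two nilpotent matrices if and only if it is singular, while a nonzero nilpotent $2 \times 2$ matrix is never such a product.) Moreover, if $A$ is singular and is not a nonzero nilpotent $2 \times 2$ matrix, then the nilpotent matrices $N_1, N_2$ with $A = N_1 N_2$ can be chosen such that $\operatorname{rank} N_1 = \operatorname{rank} N_2 = \operatorname{rank} A$. -/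

import Mathlib

open Module

section NilpotentFactorization

variable {F : Type*} [Field F] {V : Type*} [AddCommGroup V] [Module F V]

/-! Nilpotent matrices are singular, so any product of them is. In size two, trace and determinant
relations rule out nonzero nilpotent products.

For the converse, induct on dimension. If `f * f ≠ 0`, choose `p = f z` and a functional `φ` with `φ
p ≠ 0` and `φ (f p) = 1`. Then V is the direct sum of K = ker(φ ∘ f) and the line of p, and f
compresses to a singular f' on K. A factorization f' = g'h' lifts to block triangular factors [g' 0;
ξ 0] and [h' γ; 0 0], which are nilpotent because g' and h' are (`FactorsNilpotent.of_compression`).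
Controlling the range of g and the kernel of h makes the lift possible and gives the rank claim.

The induction stops at square-zero maps. It would also fail in dimension three if f' were a nonzero
square-zero map on a plane; `FactorsNilpotent.of_finrank_eq_three` covers that case with an explicit
basis. -/

/-- `f` is a product `g * h` of two nilpotent endomorphisms, where `g` has the range of `f` and
`h` has the kernel of `f`. -/
def FactorsNilpotent (f : End F V) : Prop :=
  ∃ g h : End F V, IsNilpotent g ∧ IsNilpotent h ∧ f = g * h ∧
    LinearMap.range g ≤ LinearMap.range f ∧ LinearMap.ker f ≤ LinearMap.ker h

/-- Nilpotency of `B ∘ A` passes to `A ∘ B`. -/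
theorem isNilpotent_comp_swap {U : Type*} [AddCommGroup U] [Module F U] (A : U →ₗ[F] V)
    (B : V →ₗ[F] U) (hn : IsNilpotent (B ∘ₗ A : End F U)) : IsNilpotent (A ∘ₗ B : End F V) := by
  obtain ⟨k, hk⟩ := hn
  have key : ∀ m : ℕ, ((A ∘ₗ B : End F V) ^ (m + 1)) = A ∘ₗ ((B ∘ₗ A : End F U) ^ m) ∘ₗ B := by
    intro m
    induction m with
    | zero => ext x; simp
    | succ m ih => rw [pow_succ, ih, pow_succ]; ext x; simp
  exact ⟨k + 1, by rw [key, hk]; ext x; simp⟩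

theorem factorsNilpotent_zero : FactorsNilpotent (0 : End F V) :=
  ⟨0, 0, IsNilpotent.zero, IsNilpotent.zero, by simp, le_rfl, le_rfl⟩

/-- A functional that vanishes on the kernel of a linear map factors through it. -/
theorem exists_functional_comp_eq {U : Type*} [AddCommGroup U] [Module F U] (T : U →ₗ[F] V)
    (χ : U →ₗ[F] F) (hle : LinearMap.ker T ≤ LinearMap.ker χ) :
    ∃ ξ : V →ₗ[F] F, ∀ x, ξ (T x) = χ x := by
  have hmem : χ ∈ LinearMap.range T.dualMap := by
    rw [LinearMap.range_dualMap_eq_dualAnnihilator_ker, Submodule.mem_dualAnnihilator]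
    exact fun w hw => hle hw
  obtain ⟨ξ, hξ⟩ := hmem
  exact ⟨ξ, fun x => by rw [← hξ]; rfl⟩

/-- A nilpotent endomorphism of a nontrivial space kills a nonzero vector. -/
theorem exists_ne_zero_of_isNilpotent [Nontrivial V] {g : End F V} (hg : IsNilpotent g) :
    ∃ x, x ≠ 0 ∧ g x = 0 := by
  by_contra! hc
  obtain ⟨k, hk⟩ := hg
  obtain ⟨x, hx⟩ := exists_ne (0 : V)
  have : ∀ m : ℕ, (g ^ m) x ≠ 0 := by
    intro m
    induction m with
    | zero => simpa using hx
    | succ m ih =>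
      intro h
      rw [pow_succ', Module.End.mul_apply] at h
      exact hc _ ih h
  exact this k (by rw [hk]; rfl)

/-! ### Lifting a factorization from a hyperplane -/

/-- The Schur complement reduction: `f'` is the compression of `f` to the hyperplane
`K = ker (φ ∘ f)` along `p`. -/
theorem FactorsNilpotent.of_compression {f : End F V} {φ : V →ₗ[F] F} {p : V}
    (hp : p ∈ LinearMap.range f) (hφp : φ p ≠ 0) (hφ : φ (f p) = 1)
    {K : Submodule F V} (memK : ∀ v, v ∈ K ↔ φ (f v) = 0) [Nontrivial K] {f' : End F K}
    (hf' : ∀ v, (f' v : V) = f v - φ (f (f v)) • p) (hgood : FactorsNilpotent f') :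
    FactorsNilpotent f := by
  obtain ⟨g', h', hg', hh', hgh, hrange, hker⟩ := hgood
  -- the projection onto `K` along `p`
  let π : V →ₗ[F] K := LinearMap.codRestrict K
    (LinearMap.id - (φ ∘ₗ f).smulRight p) (fun v => by
      rw [memK]; simp [hφ])
  have π_coe : ∀ v, (π v : V) = v - φ (f v) • p := fun v => rfl
  have π_K : ∀ v : K, π v = v := fun v => by
    apply Subtype.ext
    rw [π_coe, (memK v).1 v.2, zero_smul, sub_zero]
  have π_p : π p = 0 := by
    apply Subtype.ext
    rw [π_coe, hφ]; simp
  have f'_eq : ∀ v : K, f' v = π (f v) := fun v => Subtype.ext (by rw [hf', π_coe])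
  -- If `f' v = 0`, then `f v` is a multiple of `p` killed by `φ`, and `φ p ≠ 0`.
  have kerf' : ∀ v : K, f' v = 0 → f v = 0 := by
    intro v hv
    have h1 : f v = φ (f (f v)) • p := by
      rw [← sub_eq_zero, ← hf', hv]; rfl
    have h2 : φ (f v) = 0 := (memK v).1 v.2
    rw [h1] at h2
    rw [map_smul, smul_eq_mul] at h2
    rw [h1, (mul_eq_zero.1 h2).resolve_right hφp, zero_smul]
  -- the compression of `f p` lies in the range of `f'`
  obtain ⟨k', hk'⟩ : ∃ k' : K, f' k' = π (f p) := by
    obtain ⟨z, hz⟩ := hp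
    have hz' : z = (π z : V) + φ p • p := by rw [π_coe, hz]; simp
    have h1 : p = f (π z) + φ p • f p := by
      conv_lhs => rw [← hz, hz', map_add, map_smul]
    have h2 : (0 : K) = f' (π z) + φ p • π (f p) := by
      rw [f'_eq, ← map_smul, ← map_add, ← h1, π_p]
    refine ⟨-(φ p)⁻¹ • π z, ?_⟩
    rw [map_smul, eq_neg_of_add_eq_zero_left h2.symm, smul_neg, neg_smul, neg_neg, smul_smul,
      inv_mul_cancel₀ hφp, one_smul]
  obtain ⟨κ, hκ0, hκ⟩ := exists_ne_zero_of_isNilpotent hg'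
  -- Since ker f' ≤ ker h', the range of `h'` meets ker g' trivially. Thus ξ can be prescribed on
  -- that range and, independently, at `κ`.
  have disj : ∀ (v : K) (t : F), h' v + t • κ = 0 → h' v = 0 ∧ t = 0 := by
    intro v t hvt
    have h1 : f' v = 0 := by
      have := congrArg g' hvt
      rw [map_add, map_smul, hκ, smul_zero, add_zero, map_zero] at this
      rw [hgh]; exact this
    have h2 : h' v = 0 := hker h1
    rw [h2, zero_add] at hvt
    exact ⟨h2, (smul_eq_zero.1 hvt).resolve_right hκ0⟩
  have ex : ∀ c : F, ∃ ξ : K →ₗ[F] F, (∀ v : K, ξ (h' v) = φ (f (f v))) ∧ ξ κ = c := by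
    intro c
    obtain ⟨ξ, hξ⟩ := exists_functional_comp_eq (U := K × F)
      (LinearMap.coprod h' (LinearMap.toSpanSingleton F K κ))
      (LinearMap.coprod (φ ∘ₗ f ∘ₗ f ∘ₗ K.subtype) (LinearMap.toSpanSingleton F F c)) (by
        rintro ⟨v, t⟩ hvt
        rw [LinearMap.mem_ker] at hvt ⊢
        simp only [LinearMap.coprod_apply, LinearMap.toSpanSingleton_apply] at hvt ⊢
        obtain ⟨h1, rfl⟩ := disj v t hvt
        have : f' v = 0 := by rw [hgh, Module.End.mul_apply, h1, map_zero]
        simp [kerf' v this])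
    refine ⟨ξ, fun v => ?_, ?_⟩
    · simpa using hξ (v, 0)
    · simpa using hξ (0, 1)
  obtain ⟨ξ, hξ, hξκ⟩ := ex (φ (f (f p)) - φ (f (f k')))
  -- The blocks of f require g'γ = π(f p), ξ ∘ h' = φ ∘ f ∘ f on K, and ξ(γ) = φ(f(f p)). Adding `κ`
  -- leaves g'γ unchanged, and the value of ξ at `κ` corrects the last entry.
  let γ : K := h' k' + κ
  let gt : K →ₗ[F] V := K.subtype ∘ₗ g' + ξ.smulRight p
  let ht : V →ₗ[F] K := h' ∘ₗ π + (φ ∘ₗ f).smulRight γ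
  have gt_apply : ∀ w, gt w = (g' w : V) + ξ w • p := fun w => rfl
  have ht_apply : ∀ w, ht w = h' (π w) + φ (f w) • γ := fun w => rfl
  have gt_h' : ∀ v : K, gt (h' v) = f v := by
    intro v
    have : g' (h' v) = f' v := by rw [hgh]; rfl
    rw [gt_apply, hξ, this, hf']; simp
  refine ⟨gt ∘ₗ π, K.subtype ∘ₗ ht, ?_, ?_, ?_, ?_, ?_⟩
  · apply isNilpotent_comp_swap
    convert hg' using 1
    ext w : 1
    simp [gt_apply, π_K, π_p]
  · apply isNilpotent_comp_swap
    convert hh' using 1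
    ext w : 1
    simp [ht_apply, π_K, (memK w).1 w.2]
  · ext v
    have hv : f v = f (π v) + φ (f v) • f p := by rw [π_coe]; simp
    have hγ : gt γ = f p := by
      have : g' (h' k') = π (f p) := by rw [← hk', hgh]; rfl
      rw [gt_apply, map_add, map_add, hκ, hξ, hξκ, this, add_zero, π_coe]
      simp
    change f v = gt (π (ht v))
    rw [π_K, ht_apply, map_add, map_smul, hγ, gt_h', ← hv]
  · rintro _ ⟨w, rfl⟩
    obtain ⟨v, hv⟩ := hrange ⟨π w, rfl⟩
    change gt (π w) ∈ _
    rw [gt_apply, ← hv, hf']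
    exact add_mem (sub_mem ⟨_, rfl⟩ (Submodule.smul_mem _ _ hp)) (Submodule.smul_mem _ _ hp)
  · intro v hv
    rw [LinearMap.mem_ker] at hv ⊢
    have hvK : v ∈ K := by rw [memK, hv, map_zero]
    have h1 : f' ⟨v, hvK⟩ = 0 := by rw [f'_eq]; simp [hv]
    have h2 : h' ⟨v, hvK⟩ = 0 := hker h1
    change ((ht v : K) : V) = 0
    rw [ht_apply, hv, π_K ⟨v, hvK⟩, h2]
    simp

/-! ### Cases factored directly -/

/-- A factorization through the range of `f` yields a nilpotent factorization. -/
theorem FactorsNilpotent.of_rangeRestrict {f : End F V} (X : V →ₗ[F] LinearMap.range f)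
    (Y : LinearMap.range f →ₗ[F] V) (hXY : X ∘ₗ Y = LinearMap.id)
    (hX : IsNilpotent (X ∘ₗ (LinearMap.range f).subtype : End F (LinearMap.range f)))
    (hY : IsNilpotent (f.rangeRestrict ∘ₗ Y : End F (LinearMap.range f))) :
    FactorsNilpotent f := by
  refine ⟨(LinearMap.range f).subtype ∘ₗ X, Y ∘ₗ f.rangeRestrict, isNilpotent_comp_swap _ _ hX,
    isNilpotent_comp_swap _ _ hY, ?_, ?_, ?_⟩
  · ext v
    have := LinearMap.congr_fun hXY (f.rangeRestrict v)
    simp only [LinearMap.comp_apply, LinearMap.id_apply] at this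
    simp [this]
  · rintro _ ⟨w, rfl⟩
    exact (X w).2
  · intro v hv
    have : f.rangeRestrict v = 0 := Subtype.ext hv
    simp [this]

/-- In dimension at least two the identity is `S * T + X * Y` with `S` and `Y` nilpotent. -/
theorem exists_nilpotent_mul_add_mul_eq_one [FiniteDimensional F V] (hV : 2 ≤ finrank F V) :
    ∃ S T X Y : End F V, IsNilpotent S ∧ IsNilpotent Y ∧ S * T + X * Y = 1 := by
  obtain ⟨m, hm⟩ := Nat.exists_eq_add_of_le' hV
  let e : V ≃ₗ[F] (Fin (m + 2) → F) := (finBasisOfFinrankEq F V hm).equivFun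
  suffices h : ∃ S T X Y : End F (Fin (m + 2) → F), IsNilpotent S ∧ IsNilpotent Y ∧
      S * T + X * Y = 1 by
    obtain ⟨S, T, X, Y, hS, hY, h⟩ := h
    let c := e.symm.conjRingEquiv
    refine ⟨c S, c T, c X, c Y, hS.map c, hY.map c, ?_⟩
    rw [← map_mul, ← map_mul, ← map_add, h, map_one]
  let S : End F (Fin (m + 2) → F) :=
    { toFun := fun a => Fin.snoc (α := fun _ => F) (fun i => a i.succ) 0
      map_add' := fun a b => by ext i; refine Fin.lastCases ?_ (fun j => ?_) i <;> simp
      map_smul' := fun t a => by ext i; refine Fin.lastCases ?_ (fun j => ?_) i <;> simp }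
  let T : End F (Fin (m + 2) → F) :=
    { toFun := fun a => Fin.cons (α := fun _ => F) 0 (fun i => a i.castSucc)
      map_add' := fun a b => by ext i; refine Fin.cases ?_ (fun j => ?_) i <;> simp
      map_smul' := fun t a => by ext i; refine Fin.cases ?_ (fun j => ?_) i <;> simp }
  have S_castSucc : ∀ a (i : Fin (m + 1)), S a i.castSucc = a i.succ := fun a i => by simp [S]
  have S_last : ∀ a, S a (Fin.last _) = 0 := fun a => by simp [S]
  have T_succ : ∀ a (i : Fin (m + 1)), T a i.succ = a i.castSucc := fun a i => by simp [T]
  let X : End F (Fin (m + 2) → F) :=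
    (LinearMap.proj 0).smulRight (Pi.single (Fin.last (m + 1)) (1 : F))
  let Y : End F (Fin (m + 2) → F) :=
    (LinearMap.proj (Fin.last (m + 1))).smulRight (Pi.single 0 (1 : F))
  -- `S` and `T` are opposite shifts, so `S * T` is the identity except that it kills the last
  -- coordinate; `X * Y` restores it. `Y` squares to zero because the first and last indices differ,
  -- which needs dimension at least two.
  refine ⟨S, T, X, Y, ⟨m + 2, ?_⟩, ⟨2, ?_⟩, ?_⟩
  · have key : ∀ (k : ℕ) (a : Fin (m + 2) → F) (i : Fin (m + 2)), m + 2 ≤ i + k →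
        (S ^ k) a i = 0 := by
      intro k
      induction k with
      | zero => intro a i hi; omega
      | succ k ih =>
        intro a i
        rw [pow_succ', Module.End.mul_apply]
        refine Fin.lastCases ?_ (fun j => ?_) i
        · intro _; exact S_last _
        · intro hi
          rw [S_castSucc]
          apply ih
          simp at hi ⊢
          omega
    refine LinearMap.ext fun a => funext fun i => ?_
    exact key _ a i (by omega)
  · refine LinearMap.ext fun a => ?_
    simp [pow_two, Y]
  · refine LinearMap.ext fun a => funext fun i => ?_
    refine Fin.lastCases ?_ (fun j => ?_) i
    · simp [S_last, X, Y]
    · simp [S_castSucc, T_succ, X, Y]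

/-- A square-zero endomorphism of rank at least two has a nilpotent factorization. -/
theorem FactorsNilpotent.of_sq_eq_zero [FiniteDimensional F V] {f : End F V} (hf : f * f = 0)
    (hr : 2 ≤ finrank F (LinearMap.range f)) : FactorsNilpotent f := by
  obtain ⟨S, T, X, Y, hS, hY, h⟩ := exists_nilpotent_mul_add_mul_eq_one hr
  obtain ⟨s, hs⟩ := f.rangeRestrict.exists_rightInverse_of_surjective f.range_rangeRestrict
  obtain ⟨ρ, hρ⟩ := (LinearMap.range f).subtype.exists_leftInverse_of_injective
    (LinearMap.range f).ker_subtype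
  have hfi : ∀ u : LinearMap.range f, f.rangeRestrict u = 0 := by
    rintro ⟨_, v, rfl⟩
    exact Subtype.ext (LinearMap.congr_fun hf v)
  have hs' : ∀ u, f.rangeRestrict (s u) = u := LinearMap.congr_fun hs
  have hρ' : ∀ u : LinearMap.range f, ρ u = u := LinearMap.congr_fun hρ
  -- Subtracting `ρ ∘ₗ s ∘ₗ f.rangeRestrict` makes the first term vanish on the range of `s`, so the
  -- composite is exactly `S * T + X * Y`.
  refine FactorsNilpotent.of_rangeRestrict
    (S ∘ₗ (ρ - ρ ∘ₗ s ∘ₗ f.rangeRestrict) + X ∘ₗ f.rangeRestrict)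
    ((LinearMap.range f).subtype ∘ₗ T + s ∘ₗ Y) ?_ ?_ ?_
  · refine LinearMap.ext fun u => ?_
    have := LinearMap.congr_fun h u
    simp only [LinearMap.add_apply, Module.End.mul_apply, Module.End.one_apply] at this
    simp [hfi, hs', hρ', this, -LinearMap.codRestrict_apply]
  · convert hS using 1
    refine LinearMap.ext fun u => ?_
    simp [hfi, hρ']
  · convert hY using 1
    refine LinearMap.ext fun u => ?_
    change f.rangeRestrict ((T u : LinearMap.range f) + s (Y u)) = Y u
    rw [map_add, hfi, hs', zero_add]

/-- An endomorphism of rank one whose kernel is not contained in its range has a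
nilpotent factorization. -/
theorem FactorsNilpotent.of_finrank_range_eq_one {f : End F V}
    (hr : finrank F (LinearMap.range f) = 1) {y : V} (hy : f y = 0)
    (hy' : y ∉ LinearMap.range f) : FactorsNilpotent f := by
  obtain ⟨u, hu0, hu⟩ := finrank_eq_one_iff'.1 hr
  obtain ⟨x, hx, hxy⟩ :=
    LinearMap.exists_extend_of_notMem (0 : LinearMap.range f →ₗ[F] F) hy' 1
  obtain ⟨ζ, hζ⟩ := (LinearMap.toSpanSingleton F _ u).exists_leftInverse_of_injective
    (LinearMap.ker_toSpanSingleton F hu0)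
  have hζu : ζ u = 1 := by simpa using LinearMap.congr_fun hζ 1
  refine FactorsNilpotent.of_rangeRestrict (x.smulRight u) (ζ.smulRight y) ?_ ?_ ?_
  · refine LinearMap.ext fun w => ?_
    obtain ⟨c, rfl⟩ := hu w
    simp [hxy, hζu]
  · refine ⟨1, LinearMap.ext fun w => ?_⟩
    have : x w = 0 := LinearMap.congr_fun hx w
    simp [this]
  · refine ⟨1, LinearMap.ext fun w => Subtype.ext ?_⟩
    simp [hy]

/-- Two nonzero linear maps have a common vector that neither of them kills. -/
theorem exists_apply_ne_zero_and_apply_ne_zero {W₁ W₂ : Type*} [AddCommGroup W₁] [Module F W₁]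
    [AddCommGroup W₂] [Module F W₂] {a : V →ₗ[F] W₁} {b : V →ₗ[F] W₂} (ha : a ≠ 0) (hb : b ≠ 0) :
    ∃ x, a x ≠ 0 ∧ b x ≠ 0 := by
  obtain ⟨x, hx⟩ : ∃ x, a x ≠ 0 := by
    by_contra! h
    exact ha (LinearMap.ext h)
  obtain ⟨y, hy⟩ : ∃ y, b y ≠ 0 := by
    by_contra! h
    exact hb (LinearMap.ext h)
  by_cases hbx : b x = 0
  · by_cases hay : a y = 0
    · exact ⟨x + y, by simpa [hay] using hx, by simpa [hbx] using hy⟩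
    · exact ⟨y, hay, hy⟩
  · exact ⟨x, hx, hbx⟩

/-- A functional that takes a nonzero value at one nonzero vector and `1` at another. -/
theorem exists_functional_ne_zero_and_eq_one {u w : V} (hu : u ≠ 0) (hw : w ≠ 0) :
    ∃ φ : V →ₗ[F] F, φ u ≠ 0 ∧ φ w = 1 := by
  have key : ∀ v : V, v ≠ 0 → Dual.eval F V v ≠ 0 := fun v hv h =>
    hv ((forall_dual_apply_eq_zero_iff F v).1 fun φ => LinearMap.congr_fun h φ)
  obtain ⟨φ, hφu, hφw⟩ := exists_apply_ne_zero_and_apply_ne_zero (key u hu) (key w hw)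
  simp only [Dual.eval_apply] at hφu hφw
  exact ⟨(φ w)⁻¹ • φ, by simp [hφu, hφw], by simp [hφw]⟩

/-- A singular endomorphism of a three-dimensional space whose kernel meets its range has a
nilpotent factorization, unless its square is zero. -/
theorem FactorsNilpotent.of_finrank_eq_three (hV : finrank F V = 3) {f : End F V}
    (hf : f * f ≠ 0) {u : V} (hu : f u ≠ 0) (hu' : f (f u) = 0) : FactorsNilpotent f := by
  have : FiniteDimensional F V := FiniteDimensional.of_finrank_pos (by omega)
  -- Evaluating Cayley–Hamilton at `f u` and then at `u` kills the two lowest coefficients of the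
  -- characteristic polynomial.
  obtain ⟨c, hc⟩ : ∃ c : F, ∀ x, f (f (f x)) = c • f (f x) := by
    have hCH := f.aeval_self_charpoly
    have hdeg : f.charpoly.natDegree = 3 := by rw [LinearMap.charpoly_natDegree, hV]
    have hlead : f.charpoly.coeff 3 = 1 := by rw [← hdeg]; exact f.charpoly_monic
    rw [Polynomial.aeval_eq_sum_range, hdeg] at hCH
    have h : ∀ x, f.charpoly.coeff 0 • x + f.charpoly.coeff 1 • f x +
        f.charpoly.coeff 2 • f (f x) + f (f (f x)) = 0 := by
      intro x
      simpa [Finset.sum_range_succ, hlead, pow_succ] using LinearMap.congr_fun hCH x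
    have h0 : f.charpoly.coeff 0 = 0 := by
      have := h (f u)
      simp only [hu', map_zero, smul_zero, add_zero] at this
      exact (smul_eq_zero.1 this).resolve_right hu
    have h1 : f.charpoly.coeff 1 = 0 := by
      have := h u
      simp only [h0, hu', map_zero, smul_zero, add_zero, zero_smul, zero_add] at this
      exact (smul_eq_zero.1 this).resolve_right hu
    refine ⟨-f.charpoly.coeff 2, fun x => ?_⟩
    have := h x
    rw [h0, h1, zero_smul, zero_smul, zero_add, zero_add] at this
    rw [neg_smul]
    exact eq_neg_of_add_eq_zero_right this
  have hf' : f * f - c • f ≠ 0 := by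
    intro h
    have h' : ∀ x, f (f x) = c • f x := fun x => sub_eq_zero.1 (LinearMap.congr_fun h x)
    have hc0 : c = 0 := by
      have := h' u
      rw [hu'] at this
      exact (smul_eq_zero.1 this.symm).resolve_right hu
    exact hf (LinearMap.ext fun x => by simp [h', hc0])
  obtain ⟨w, hw, hw'⟩ := exists_apply_ne_zero_and_apply_ne_zero hf hf'
  simp only [Module.End.mul_apply, LinearMap.sub_apply, LinearMap.smul_apply] at hw hw'
  set z := f (f w) - c • f w with hz
  have hfz : f z = 0 := by rw [hz, map_sub, map_smul, hc, sub_self]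
  have hffw : f (f w) = c • f w + z := by rw [hz]; abel
  have hpair : ∀ s t : F, s • f w + t • z = 0 → s = 0 ∧ t = 0 := by
    intro s t h
    have h1 := congrArg f h
    rw [map_add, map_smul, map_smul, hfz, smul_zero, add_zero, map_zero] at h1
    obtain rfl := (smul_eq_zero.1 h1).resolve_right hw
    rw [zero_smul, zero_add] at h
    exact ⟨rfl, (smul_eq_zero.1 h).resolve_right hw'⟩
  have hind : ∀ r s t : F, f (r • f w + s • w + t • z) = 0 → r = 0 ∧ s = 0 := by
    intro r s t h
    rw [map_add, map_add, map_smul, map_smul, map_smul, hfz, hffw, smul_zero, add_zero] at h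
    obtain ⟨h1, h2⟩ := hpair (r * c + s) r (by rw [← h]; module)
    subst h2
    exact ⟨rfl, by simpa using h1⟩
  have hli : LinearIndependent F ![f w, w, z] := by
    rw [Fintype.linearIndependent_iff]
    intro a ha
    simp only [Fin.sum_univ_three, Matrix.cons_val] at ha
    obtain ⟨h0, h1⟩ := hind (a 0) (a 1) (a 2) (by rw [ha, map_zero])
    rw [h0, h1, zero_smul, zero_smul, zero_add, zero_add] at ha
    have h2 := (smul_eq_zero.1 ha).resolve_right hw'
    intro i
    fin_cases i <;> assumption
  let b := basisOfLinearIndependentOfCardEqFinrank hli (by simp [hV])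
  have hb : ⇑b = ![f w, w, z] := coe_basisOfLinearIndependentOfCardEqFinrank _ _
  -- `h` is the chain f w ↦ w ↦ z ↦ 0. `g` then has to undo it on images: since f²w = c·f w + z, it
  -- acts by w ↦ f²w ↦ f w ↦ 0.
  let g : End F V := b.constr F ![0, f (f w), f w]
  let h : End F V := b.constr F ![w, z, 0]
  have hbg : ∀ i, g (b i) = ![0, f (f w), f w] i := fun i => b.constr_basis F _ i
  have hbh : ∀ i, h (b i) = ![w, z, 0] i := fun i => b.constr_basis F _ i
  rw [hb] at hbg hbh
  have g0 : g (f w) = 0 := hbg 0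
  have g1 : g w = f (f w) := hbg 1
  have g2 : g z = f w := hbg 2
  have h0 : h (f w) = w := hbh 0
  have h1 : h w = z := hbh 1
  have h2 : h z = 0 := hbh 2
  have gff : g (f (f w)) = f w := by rw [hffw, map_add, map_smul, g0, g2, smul_zero, zero_add]
  refine ⟨g, h, ⟨3, b.ext fun i => ?_⟩, ⟨3, b.ext fun i => ?_⟩, b.ext fun i => ?_, ?_, ?_⟩
  · rw [hb]; fin_cases i <;> simp [pow_succ, g0, g1, g2, gff]
  · rw [hb]; fin_cases i <;> simp [pow_succ, h0, h1, h2]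
  · rw [hb]; fin_cases i <;> simp [h0, h1, h2, g1, g2, hfz]
  · rw [b.constr_range, Submodule.span_le]
    rintro _ ⟨i, rfl⟩
    fin_cases i
    · exact zero_mem _
    · exact ⟨f w, rfl⟩
    · exact ⟨w, rfl⟩
  · intro v hv
    rw [LinearMap.mem_ker] at hv ⊢
    have hsum := b.sum_repr v
    rw [Fin.sum_univ_three, hb] at hsum
    simp only [Matrix.cons_val] at hsum
    rw [← hsum] at hv ⊢
    obtain ⟨e0, e1⟩ := hind _ _ _ hv
    simp [e0, e1, h2]

/-- A singular square-zero endomorphism has a nilpotent factorization, unless it is nonzero and the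
space is two-dimensional. -/
theorem FactorsNilpotent.of_sq_eq_zero_of_finrank_ne_two [FiniteDimensional F V] {f : End F V}
    (hf : f * f = 0) (hf2 : ¬ (finrank F V = 2 ∧ f ≠ 0)) : FactorsNilpotent f := by
  rcases eq_or_ne f 0 with rfl | hf0
  · exact factorsNilpotent_zero
  have hV : finrank F V ≠ 2 := fun h => hf2 ⟨h, hf0⟩
  rcases le_or_gt 2 (finrank F (LinearMap.range f)) with hr | hr
  · exact .of_sq_eq_zero hf hr
  have hr1 : finrank F (LinearMap.range f) = 1 := by
    have : finrank F (LinearMap.range f) ≠ 0 := fun h =>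
      hf0 (LinearMap.range_eq_bot.1 (Submodule.finrank_eq_zero.1 h))
    omega
  have hle : LinearMap.range f ≤ LinearMap.ker f := by
    rintro _ ⟨v, rfl⟩
    exact LinearMap.congr_fun hf v
  have hlt : LinearMap.range f < LinearMap.ker f := by
    refine lt_of_le_of_ne hle fun h => hV ?_
    rw [← f.finrank_range_add_finrank_ker, ← h, hr1]
  obtain ⟨y, hy, hy'⟩ := Set.exists_of_ssubset hlt
  exact .of_finrank_range_eq_one hr1 hy hy'

/-! ### The induction on dimension -/

/-- If the kernel of `f` is not contained in its range then `f` is not a nonzero square-zero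
endomorphism of a two-dimensional space. -/
theorem eq_zero_of_sq_eq_zero_of_ker_not_le_range [FiniteDimensional F V] (hV : finrank F V = 2)
    {f : End F V} (hf : f * f = 0) (hker : ¬ LinearMap.ker f ≤ LinearMap.range f) : f = 0 := by
  have hle : LinearMap.range f ≤ LinearMap.ker f := by
    rintro _ ⟨v, rfl⟩
    exact LinearMap.congr_fun hf v
  have hlt : LinearMap.range f < LinearMap.ker f := lt_of_le_not_ge hle hker
  have h1 := Submodule.finrank_lt_finrank_of_lt hlt
  have h2 := f.finrank_range_add_finrank_ker
  exact LinearMap.range_eq_bot.1 (Submodule.finrank_eq_zero.1 (by omega))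

/-- Every singular endomorphism other than a nonzero square-zero one in dimension two has a
nilpotent factorization. -/
theorem factorsNilpotent_of_ker_ne_bot [FiniteDimensional F V] {f : End F V}
    (hker : LinearMap.ker f ≠ ⊥) (hf2 : ¬ (finrank F V = 2 ∧ f * f = 0 ∧ f ≠ 0)) :
    FactorsNilpotent f := by
  induction hn : finrank F V using Nat.strong_induction_on generalizing V with
  | _ n ih =>
  by_cases hff : f * f = 0
  · exact .of_sq_eq_zero_of_finrank_ne_two hff fun h => hf2 ⟨h.1, hff, h.2⟩
  by_cases h3 : finrank F V = 3 ∧ ∃ u, f u ≠ 0 ∧ f (f u) = 0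
  · obtain ⟨h3, u, hu, hu'⟩ := h3
    exact .of_finrank_eq_three h3 hff hu hu'
  obtain ⟨z, hz⟩ : ∃ z, f (f z) ≠ 0 := by
    by_contra! h
    exact hff (LinearMap.ext h)
  have hz' : f z ≠ 0 := fun h => hz (by rw [h, map_zero])
  obtain ⟨φ, hφp, hφ⟩ := exists_functional_ne_zero_and_eq_one (F := F) hz' hz
  obtain ⟨k, hk, hk0⟩ := Submodule.exists_mem_ne_zero_of_ne_bot hker
  rw [LinearMap.mem_ker] at hk
  let K := LinearMap.ker (φ ∘ₗ f)
  have memK : ∀ v, v ∈ K ↔ φ (f v) = 0 := fun v => by simp [K]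
  have kmem : ∀ v, f v = 0 → v ∈ K := fun v hv => by rw [memK, hv, map_zero]
  let f' : End F K := LinearMap.codRestrict K
    ((f - (φ ∘ₗ f ∘ₗ f).smulRight (f z)) ∘ₗ K.subtype) (fun v => by rw [memK]; simp [hφ])
  have hf' : ∀ v, (f' v : V) = f v - φ (f (f v)) • f z := fun v => rfl
  have f'_zero : ∀ v (hv : f v = 0), f' ⟨v, kmem v hv⟩ = 0 := fun v hv =>
    Subtype.ext (by rw [hf']; simp [hv])
  have hkK : (⟨k, kmem k hk⟩ : K) ≠ 0 := fun h => hk0 (congrArg Subtype.val h)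
  have : Nontrivial K := ⟨_, _, hkK⟩
  have hlt : finrank F K < finrank F V := by
    refine Submodule.finrank_lt fun h => ?_
    have : f z ∈ K := by rw [h]; trivial
    rw [memK, hφ] at this
    exact one_ne_zero this
  have hcodim : finrank F V ≤ finrank F K + 1 := by
    have h1 := (φ ∘ₗ f).finrank_range_add_finrank_ker
    have h2 := Submodule.finrank_le (LinearMap.range (φ ∘ₗ f))
    rw [finrank_self] at h2
    change _ + finrank F K = _ at h1
    omega
  refine FactorsNilpotent.of_compression ⟨z, rfl⟩ hφp hφ memK hf' (ih _ (hn ▸ hlt) ?_ ?_ rfl)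
  · intro h
    have : (⟨k, kmem k hk⟩ : K) ∈ LinearMap.ker f' := f'_zero k hk
    rw [h, Submodule.mem_bot] at this
    exact hkK this
  -- In the forbidden case ker f' lies in the range of f', so `k` = f' v = f(v − φ(f(f v))·z). This
  -- is a nonzero kernel vector in the range of f in dimension three, the case already removed by
  -- `h3`.
  · rintro ⟨hK2, hsq, hne⟩
    refine hne (eq_zero_of_sq_eq_zero_of_ker_not_le_range hK2 hsq fun hle => ?_)
    obtain ⟨v, hv⟩ := hle (f'_zero k hk)
    refine h3 ⟨by omega, v - φ (f (f v)) • z, ?_⟩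
    have : f (v - φ (f (f v)) • z) = k := by
      rw [map_sub, map_smul, ← hf', hv]
    rw [this]
    exact ⟨hk0, hk⟩

/-- As f = gh, the inclusions of range and kernel are equalities; the first gives the rank of g, the
second that of h by rank–nullity. -/
theorem FactorsNilpotent.exists_matrix {n : ℕ} {A : Matrix (Fin n) (Fin n) F}
    (hA : FactorsNilpotent (Matrix.toLin' A)) :
    ∃ N₁ N₂ : Matrix (Fin n) (Fin n) F, IsNilpotent N₁ ∧ IsNilpotent N₂ ∧
        A = N₁ * N₂ ∧ N₁.rank = A.rank ∧ N₂.rank = A.rank := by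
  obtain ⟨g, h, hg, hh, hgh, hrange, hker⟩ := hA
  have rank_eq : ∀ e : End F (Fin n → F), (LinearMap.toMatrix' e).rank =
      finrank F (LinearMap.range e) := fun e => by
    rw [Matrix.rank, ← Matrix.toLin'_apply', Matrix.toLin'_toMatrix']
  have hA' : A = LinearMap.toMatrix' (g * h) := by rw [← hgh, LinearMap.toMatrix'_toLin']
  rw [hgh] at hrange hker
  have hr : LinearMap.range (g * h) = LinearMap.range g :=
    le_antisymm (LinearMap.range_comp_le_range h g) hrange
  have hk : LinearMap.ker (g * h) = LinearMap.ker h :=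
    le_antisymm hker (LinearMap.ker_le_ker_comp h g)
  refine ⟨LinearMap.toMatrix' g, LinearMap.toMatrix' h,
    hg.map LinearMap.toMatrixAlgEquiv', hh.map LinearMap.toMatrixAlgEquiv',
    by rw [hA', LinearMap.toMatrix'_mul], ?_, ?_⟩
  · rw [hA', rank_eq, rank_eq, hr]
  · rw [hA', rank_eq, rank_eq]
    have h1 := (g * h).finrank_range_add_finrank_ker
    have h2 := h.finrank_range_add_finrank_ker
    rw [hk] at h1
    omega

end NilpotentFactorization

/-! ### The obstruction in size two -/

section TwoByTwo

variable {F : Type*} [Field F]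

theorem Matrix.det_eq_zero_of_isNilpotent {n : ℕ} (hn : 1 ≤ n) {N : Matrix (Fin n) (Fin n) F}
    (hN : IsNilpotent N) : N.det = 0 := by
  obtain ⟨k, hk⟩ := hN
  have : Nonempty (Fin n) := ⟨⟨0, hn⟩⟩
  refine eq_zero_of_pow_eq_zero (n := k) ?_
  rw [← Matrix.det_pow, hk, Matrix.det_zero]

/-- The entries of a nilpotent `2 × 2` matrix. -/
theorem Matrix.entries_of_isNilpotent_fin_two {N : Matrix (Fin 2) (Fin 2) F}
    (hN : IsNilpotent N) : N 1 1 = -N 0 0 ∧ N 0 0 * N 0 0 = -(N 0 1 * N 1 0) := by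
  have ht : N.trace = 0 := (Matrix.isNilpotent_trace_of_isNilpotent hN).eq_zero
  have hd : N.det = 0 := Matrix.det_eq_zero_of_isNilpotent one_le_two hN
  rw [Matrix.trace_fin_two] at ht
  rw [Matrix.det_fin_two] at hd
  have h1 : N 1 1 = -N 0 0 := eq_neg_of_add_eq_zero_right ht
  exact ⟨h1, by rw [h1] at hd; linear_combination -hd⟩

/-- A product of two nilpotent `2 × 2` matrices is zero if it is nilpotent. -/
theorem Matrix.mul_eq_zero_of_isNilpotent_fin_two {M N : Matrix (Fin 2) (Fin 2) F}
    (hM : IsNilpotent M) (hN : IsNilpotent N) (hMN : IsNilpotent (M * N)) : M * N = 0 := by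
  obtain ⟨m1, m2⟩ := Matrix.entries_of_isNilpotent_fin_two hM
  obtain ⟨n1, n2⟩ := Matrix.entries_of_isNilpotent_fin_two hN
  obtain ⟨t, -⟩ := Matrix.entries_of_isNilpotent_fin_two hMN
  simp only [Matrix.mul_apply, Fin.sum_univ_two, m1, n1] at t
  generalize ha : M 0 0 = a at *
  generalize hb : M 0 1 = b at *
  generalize hc : M 1 0 = c at *
  generalize hd : N 0 0 = d at *
  generalize he : N 0 1 = e at *
  generalize hk : N 1 0 = k at *
  -- Modulo the two determinant relations, the square of each entry is a multiple of the trace of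
  -- the product, which vanishes.
  have h00 : a * d + b * k = 0 := eq_zero_of_pow_eq_zero (n := 2) <| by
    linear_combination d * d * m2 - b * c * n2 + b * k * t
  have h01 : a * e + b * -d = 0 := eq_zero_of_pow_eq_zero (n := 2) <| by
    linear_combination e * e * m2 + b * b * n2 - b * e * t
  have h10 : c * d + -a * k = 0 := eq_zero_of_pow_eq_zero (n := 2) <| by
    linear_combination k * k * m2 + c * c * n2 - c * k * t
  have h11 : c * e + -a * -d = 0 := by rw [t, h00, neg_zero]
  ext i j
  fin_cases i <;> fin_cases j <;>
    simp [Matrix.mul_apply, Fin.sum_univ_two, ha, hb, hc, hd, he, hk, m1, n1] <;>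
    grind

end TwoByTwo

theorem mainTheorem1 {F : Type*} [Field F] {n : ℕ} (hn : 1 ≤ n)
    (A : Matrix (Fin n) (Fin n) F) :
    ((∃ N₁ N₂ : Matrix (Fin n) (Fin n) F, IsNilpotent N₁ ∧ IsNilpotent N₂ ∧ A = N₁ * N₂) ↔
      (A.det = 0 ∧ ¬ (n = 2 ∧ IsNilpotent A ∧ A ≠ 0))) ∧
    (A.det = 0 → ¬ (n = 2 ∧ IsNilpotent A ∧ A ≠ 0) →
      ∃ N₁ N₂ : Matrix (Fin n) (Fin n) F, IsNilpotent N₁ ∧ IsNilpotent N₂ ∧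
        A = N₁ * N₂ ∧ N₁.rank = A.rank ∧ N₂.rank = A.rank) := by
  have key : A.det = 0 → ¬ (n = 2 ∧ IsNilpotent A ∧ A ≠ 0) →
      ∃ N₁ N₂ : Matrix (Fin n) (Fin n) F, IsNilpotent N₁ ∧ IsNilpotent N₂ ∧
        A = N₁ * N₂ ∧ N₁.rank = A.rank ∧ N₂.rank = A.rank := by
    intro hdet hA
    refine (factorsNilpotent_of_ker_ne_bot ?_ ?_).exists_matrix
    · intro hbot
      obtain ⟨v, hv, hAv⟩ := Matrix.exists_mulVec_eq_zero_iff.2 hdet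
      have : v ∈ LinearMap.ker (Matrix.toLin' A) := by simpa using hAv
      rw [hbot, Submodule.mem_bot] at this
      exact hv this
    · rintro ⟨h2, hsq, h0⟩
      refine hA ⟨by simpa using h2, ⟨2, ?_⟩, fun h => h0 (by rw [h, map_zero])⟩
      apply Matrix.toLin'.injective
      rw [pow_two, Matrix.toLin'_mul, map_zero]
      exact hsq
  refine ⟨⟨?_, fun h => ?_⟩, key⟩
  · rintro ⟨N₁, N₂, h₁, h₂, rfl⟩
    constructor
    · rw [Matrix.det_mul, Matrix.det_eq_zero_of_isNilpotent hn h₁, zero_mul]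
    · rintro ⟨rfl, hnil, h0⟩
      exact h0 (Matrix.mul_eq_zero_of_isNilpotent_fin_two h₁ h₂ hnil)
  · obtain ⟨N₁, N₂, h₁, h₂, h, -⟩ := key h.1 h.2
    exact ⟨N₁, N₂, h₁, h₂, h⟩
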